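/- All graphs are finite, simple and undirected. For a positive integer $n$, a \emph{circulant graph of order $n$} is a Cayley graph $\mathrm{Cay}(\mathbb{Z}_n,S)$, where $S\subseteq\mathbb{Z}_n$ satisfies $0\notin S$ and $-S=S$; its vertices are the elements of $\mathbb{Z}_n$, and $v$ is adjacent to $w$ if and only if $w-v\in S$. The \emph{canonical bipartite double cover} $BX$ of a graph $X$ has vertex set $V(X)\times\{0,1\}$; its edges join $(v,0)$ to $(w,1)$ exactly when $v$ and $w$ are adjacent in $X$. The group $\operatorname{Aut}X\times S_2$ acts on $BX$ by $(\alpha,\sigma)(v,i)=(\alpha(v),\sigma(i))$, and $X$ is \emph{unstable} if $\operatorname{Aut}BX\neq\operatorname{Aut}X\times S_2$, that is, if some automorphism of $BX$ is not of this form. A graph is \emph{twin-free} if no two distinct vertices have exactly the same neighbors. A graph is \emph{nontrivially unstable} if it is connected, nonbipartite, twin-free and unstable. \textbf{Corollary.} Let $n$ be a positive integer. There does not exist a nontrivially unstable circulant graph of order $n$ if and only if either $n$ is odd, or $n<8$, or $n=2p$ for some prime number $p\equiv 3\pmod 4$. -/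

import Mathlib

namespace SimpleGraph

variable {V : Type*}

/-- A graph is twin-free if no two distinct vertices have exactly the same neighbours. -/
def IsTwinFree (X : SimpleGraph V) : Prop :=
  ∀ u v : V, u ≠ v → X.neighborSet u ≠ X.neighborSet v

/-- The map `(v, i) ↦ (α v, σ i)` on the vertices of the canonical bipartite double cover, where the
layers `0` and `1` of `V ⊕ V` are indexed by `Bool` through `Equiv.boolProdEquivSum`. -/
def coverPerm (α : Equiv.Perm V) (σ : Equiv.Perm Bool) : Equiv.Perm (V ⊕ V) :=
  ((Equiv.boolProdEquivSum V).symm.trans (σ.prodCongr α)).trans (Equiv.boolProdEquivSum V)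

theorem coverPerm_adj (X : SimpleGraph V) (α : X ≃g X) (σ : Equiv.Perm Bool) (a b : V ⊕ V) :
    X.bipartiteDoubleCover.Adj (coverPerm α.toEquiv σ a) (coverPerm α.toEquiv σ b) ↔
      X.bipartiteDoubleCover.Adj a b := by
  have hσ : σ true ≠ σ false := fun h => by simpa using σ.injective h
  rcases h0 : σ false <;> rcases h1 : σ true <;> rw [h0, h1] at hσ <;>
    rcases a with a | a <;> rcases b with b | b <;>
    simp_all [coverPerm, Equiv.boolProdEquivSum] <;> exact α.map_rel_iff

/-- The canonical homomorphism `Aut X × S₂ → Aut BX`, in which `(α, σ)` acts by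
`(v, i) ↦ (α v, σ i)`. -/
def coverAut (X : SimpleGraph V) :
    (X ≃g X) × Equiv.Perm Bool →* (X.bipartiteDoubleCover ≃g X.bipartiteDoubleCover) where
  toFun p := ⟨coverPerm p.1.toEquiv p.2, coverPerm_adj X p.1 p.2 _ _⟩
  map_one' := by
    ext a
    rcases a with a | a <;> rfl
  map_mul' p q := by
    apply RelIso.ext
    intro a
    change Equiv.boolProdEquivSum V (((p.2 * q.2).prodCongr (p.1 * q.1).toEquiv)
        ((Equiv.boolProdEquivSum V).symm a)) =
      Equiv.boolProdEquivSum V ((p.2.prodCongr p.1.toEquiv) ((Equiv.boolProdEquivSum V).symm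
        (Equiv.boolProdEquivSum V ((q.2.prodCongr q.1.toEquiv)
          ((Equiv.boolProdEquivSum V).symm a)))))
    rw [Equiv.symm_apply_apply]
    rfl

/-- `X` is unstable if `Aut X × S₂`, as a subgroup of `Aut BX`, is not all of `Aut BX`. -/
def IsUnstable (X : SimpleGraph V) : Prop :=
  X.coverAut.range ≠ ⊤

/-- `X` is nontrivially unstable if it is connected, nonbipartite, twin-free and unstable. -/
def IsNontriviallyUnstable (X : SimpleGraph V) : Prop :=
  X.Connected ∧ ¬ X.IsBipartite ∧ X.IsTwinFree ∧ X.IsUnstable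

end SimpleGraph

/-! For a connected nonbipartite graph, instability means that some pair `f ≠ g` of permutations of
the vertices satisfies `f x ~ g y ↔ x ~ y`. For a circulant graph this reads `g y - f x ∈ S ↔ y - x
∈ S`, so the adjacency operator `A` intertwines: `A (u ∘ g) = A u ∘ f`. Even powers of `A` therefore
commute with composition by `f`, while odd powers exchange `g` for `f`. Over a field of
characteristic `p`, Frobenius turns `A ^ p ^ k` into the operator of the multiset `p ^ k • S`, which
gives new relations between `f` and `g`.

Odd `n`: since `2 ^ φ(n) ≡ 1` mod `n`, an even power of `A` over `ZMod 2` is `A` itself. So `f` is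
an automorphism, and twin-freeness forces `f = g` (`PreservesDiff.self_of_odd`).

`n = 2p`, `p ≡ 3` mod 4: the `p`-th power shows that `f x` and `g x` differ at most by the
involution `w`, and the square controls parity. If `f ≠ g`, then `g = f + w`, and `f` induces a
permutation of `ZMod p` interchanging the even and odd layers of `S`. By Sylow it may be replaced by
a multiplication, and as `(p - 1) / 2` is odd the layers coincide, which creates twins
(`eq_of_diff_swap`, `PreservesDiff.eq_of_three_mod_four`).

The remaining orders are `2ab` with `a, b ≥ 2` and `2p` with `p ≡ 1` mod 4. The first is handled by
translating only one parity class, the second by a square root of `-1`. -/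

namespace SimpleGraph

/-! ### Instability and two-fold automorphisms -/

/-- A pair of permutations is a two-fold automorphism of `X` if it acts, layer by layer, as an
automorphism of the canonical bipartite double cover. -/
def IsTwoFoldAut {V : Type*} (X : SimpleGraph V) (f g : Equiv.Perm V) : Prop :=
  ∀ x y, X.Adj (f x) (g y) ↔ X.Adj x y

/-- The automorphism of the canonical bipartite double cover given by a two-fold automorphism. -/
def IsTwoFoldAut.coverIso {V : Type*} {X : SimpleGraph V} {f g : Equiv.Perm V}
    (h : X.IsTwoFoldAut f g) : X.bipartiteDoubleCover ≃g X.bipartiteDoubleCover where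
  toEquiv := Equiv.sumCongr f g
  map_rel_iff' := by
    rintro (a | a) (b | b)
    · simp
    · simpa using h a b
    · simpa [X.adj_comm] using h b a
    · simp

theorem IsTwoFoldAut.isUnstable {V : Type*} [Nonempty V] {X : SimpleGraph V} {f g : Equiv.Perm V}
    (h : X.IsTwoFoldAut f g) (hfg : f ≠ g) : X.IsUnstable := by
  intro htop
  obtain ⟨⟨α, σ⟩, hα⟩ : h.coverIso ∈ X.coverAut.range := htop ▸ Subgroup.mem_top _
  have key (a : V ⊕ V) : coverPerm α.toEquiv σ a = Equiv.sumCongr f g a := DFunLike.congr_fun hα a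
  have hl (x : V) := key (Sum.inl x)
  have hr (x : V) := key (Sum.inr x)
  rcases h0 : σ false <;> rcases h1 : σ true <;>
    simp_all [coverPerm, Equiv.boolProdEquivSum]
  exact hfg (Equiv.ext hr)

/-- Every automorphism of the canonical bipartite double cover of a connected nonbipartite graph
preserves or interchanges the two layers. -/
theorem coverIso_isLeft {V : Type*} {X : SimpleGraph V} (hc : X.Connected) (hb : ¬ X.IsBipartite)
    (φ : X.bipartiteDoubleCover ≃g X.bipartiteDoubleCover) :
    ∃ c : Bool, ∀ v, (φ (Sum.inl v)).isLeft = c ∧ (φ (Sum.inr v)).isLeft = !c := by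
  have layer {a b : V ⊕ V} (h : X.bipartiteDoubleCover.Adj a b) : a.isLeft = !b.isLeft := by
    rcases a with a | a <;> rcases b with b | b <;> simp_all
  have hlr {v w : V} (h : X.Adj v w) :
      (φ (Sum.inl v)).isLeft = !(φ (Sum.inr w)).isLeft :=
    layer (φ.map_rel_iff.2 (by simpa using h))
  have const {β : Type} {c : V → β} (h : ∀ v w, X.Adj v w → c v = c w) (v w : V) : c v = c w := by
    obtain ⟨p⟩ := hc.preconnected v w
    induction p with
    | nil => rfl
    | cons hadj _ ih => exact (h _ _ hadj).trans ih
  -- Whether the two lifts of a vertex land in the same layer is constant along edges. If they do,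
  -- the layer is a proper 2-colouring of `X`.
  have hxor := const (c := fun v => xor (φ (Sum.inl v)).isLeft (φ (Sum.inr v)).isLeft)
    fun v w h => by
      simp only [hlr h, hlr h.symm]
      rcases (φ (Sum.inr v)).isLeft <;> rcases (φ (Sum.inr w)).isLeft <;> rfl
  obtain ⟨v₀⟩ := hc.nonempty
  rcases hx : xor (φ (Sum.inl v₀)).isLeft (φ (Sum.inr v₀)).isLeft
  · refine absurd ?_ hb
    have hcol : X.Coloring Bool := Coloring.mk (fun v => (φ (Sum.inl v)).isLeft) fun {v w} h => by
      have h1 := (hxor w v₀).trans hx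
      have h2 := hlr h
      simp only [bne_eq_false_iff_eq] at h1
      rw [h2, h1]
      exact Bool.not_ne_self _
    exact hcol.colorable
  · refine ⟨(φ (Sum.inl v₀)).isLeft, fun v => ?_⟩
    have hop (u : V) : (φ (Sum.inr u)).isLeft = !(φ (Sum.inl u)).isLeft := by
      have h1 := (hxor u v₀).trans hx
      revert h1
      rcases (φ (Sum.inr u)).isLeft <;> rcases (φ (Sum.inl u)).isLeft <;> simp
    have h2 := const (c := fun v => (φ (Sum.inl v)).isLeft)
      (fun v w h => by simp only [hlr h, hop, Bool.not_not]) v v₀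
    exact ⟨h2, by rw [hop]; exact congrArg _ h2⟩

/-- An automorphism of the canonical bipartite double cover that preserves both layers comes from a
two-fold automorphism. -/
theorem exists_isTwoFoldAut_of_isLeft {V : Type*} [Finite V] {X : SimpleGraph V}
    (φ : X.bipartiteDoubleCover ≃g X.bipartiteDoubleCover)
    (hl : ∀ v, (φ (Sum.inl v)).isLeft = true) (hr : ∀ v, (φ (Sum.inr v)).isLeft = false) :
    ∃ f g : Equiv.Perm V, X.IsTwoFoldAut f g ∧ ∀ a, φ a = Equiv.sumCongr f g a := by
  choose f hf using fun v => Sum.isLeft_iff.1 (hl v)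
  choose g hg using fun v => Sum.isRight_iff.1 (Sum.isLeft_eq_false.1 (hr v))
  have hfi : Function.Injective f := fun x y h =>
    Sum.inl_injective (φ.injective (by rw [hf, hf, h]))
  have hgi : Function.Injective g := fun x y h =>
    Sum.inr_injective (φ.injective (by rw [hg, hg, h]))
  refine ⟨Equiv.ofBijective f (Finite.injective_iff_bijective.1 hfi),
    Equiv.ofBijective g (Finite.injective_iff_bijective.1 hgi), fun x y => ?_, ?_⟩
  · have := φ.map_rel_iff (a := Sum.inl x) (b := Sum.inr y)
    rw [hf, hg] at this
    simpa using this
  · rintro (a | a)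
    · exact hf a
    · exact hg a

/-- An automorphism that interchanges the layers becomes layer-preserving after composition with the
layer swap, which lies in the range of `coverAut`. -/
theorem not_isUnstable_of_forall_isTwoFoldAut {V : Type*} [Finite V] {X : SimpleGraph V}
    (hc : X.Connected) (hb : ¬ X.IsBipartite)
    (h : ∀ f g : Equiv.Perm V, X.IsTwoFoldAut f g → f = g) : ¬ X.IsUnstable := by
  have preserving (φ : X.bipartiteDoubleCover ≃g X.bipartiteDoubleCover)
      (hl : ∀ v, (φ (Sum.inl v)).isLeft = true) (hr : ∀ v, (φ (Sum.inr v)).isLeft = false) :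
      φ ∈ X.coverAut.range := by
    obtain ⟨f, g, hfg, hφ⟩ := exists_isTwoFoldAut_of_isLeft φ hl hr
    obtain rfl := h f g hfg
    refine ⟨(⟨f, fun {a b} => hfg a b⟩, 1), RelIso.ext fun a => ?_⟩
    rw [hφ]
    rcases a with a | a <;> rfl
  refine not_not.2 ((Subgroup.eq_top_iff' _).2 fun φ => ?_)
  obtain ⟨c, hφ⟩ := coverIso_isLeft hc hb φ
  rcases c
  · let τ := X.coverAut (1, Equiv.swap false true)
    have hτl (v : V) : τ (Sum.inl v) = Sum.inr v := rfl
    have hτr (v : V) : τ (Sum.inr v) = Sum.inl v := rfl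
    have hmem : φ * τ ∈ X.coverAut.range := preserving _
      (fun v => (hφ v).2) (fun v => (hφ v).1)
    exact (Subgroup.mul_mem_cancel_right _ (MonoidHom.mem_range.2 ⟨_, rfl⟩)).1 hmem
  · exact preserving φ (fun v => (hφ v).1) fun v => by simpa using (hφ v).2

end SimpleGraph

/-! ### Adjacency operators and Frobenius -/

/-- The translation operator `h ↦ h (· + s)` on functions. -/
def translateOp (F : Type*) {G : Type*} [AddCommGroup G] [CommRing F] (s : G) :
    Module.End F (G → F) :=
  LinearMap.funLeft F F (· + s)

theorem translateOp_apply {F G : Type*} [AddCommGroup G] [CommRing F] (s : G) (h : G → F) (x : G) :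
    translateOp F s h x = h (x + s) := rfl

theorem translateOp_commute {F G : Type*} [AddCommGroup G] [CommRing F] (s t : G) :
    Commute (translateOp F s) (translateOp F t) := by
  refine LinearMap.ext fun h => funext fun x => ?_
  simp only [Module.End.mul_apply, translateOp_apply]
  congr 1
  abel

theorem translateOp_pow {F G : Type*} [AddCommGroup G] [CommRing F] (s : G) (k : ℕ) :
    translateOp F s ^ k = translateOp F (k • s) := by
  induction k with
  | zero => exact LinearMap.ext fun h => funext fun x => by simp [translateOp_apply]
  | succ k ih =>
    refine LinearMap.ext fun h => funext fun x => ?_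
    rw [pow_succ, ih]
    simp only [Module.End.mul_apply, translateOp_apply]
    congr 1
    rw [succ_nsmul, add_assoc]

/-- The adjacency operator `h ↦ ∑ s ∈ S, h (· + s)` of a Cayley graph. -/
def cayleyOp (F : Type*) {G : Type*} [AddCommGroup G] [CommRing F] (S : Finset G) :
    Module.End F (G → F) :=
  ∑ s ∈ S, translateOp F s

theorem cayleyOp_apply {F G : Type*} [AddCommGroup G] [CommRing F] (S : Finset G) (h : G → F)
    (x : G) : cayleyOp F S h x = ∑ s ∈ S, h (x + s) := by
  simp [cayleyOp, translateOp_apply]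

/-- Commutation of the summands suffices for Frobenius; the ambient endomorphism ring is not
commutative. -/
theorem sum_pow_char_pow_of_commute {R ι : Type*} [Semiring R] (p : ℕ) [Fact p.Prime] [CharP R p]
    (k : ℕ) (a : ι → R) (ha : ∀ i j, Commute (a i) (a j)) (S : Finset ι) :
    (∑ i ∈ S, a i) ^ p ^ k = ∑ i ∈ S, a i ^ p ^ k := by
  classical
  induction S using Finset.induction_on with
  | empty => simp [(Fact.out : p.Prime).ne_zero]
  | insert i S hi ih =>
    rw [Finset.sum_insert hi, Finset.sum_insert hi, ← ih]
    exact add_pow_char_pow_of_commute _ _ (Commute.sum_right _ _ _ fun j _ => ha i j)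

instance {F G : Type*} [AddCommGroup G] [Field F] (p : ℕ) [CharP F p] :
    CharP (Module.End F (G → F)) p :=
  charP_of_injective_algebraMap (algebraMap F (Module.End F (G → F))).injective p

theorem cayleyOp_pow_apply {F G : Type*} [AddCommGroup G] [Field F] (p : ℕ)
    [Fact p.Prime] [CharP F p] (k : ℕ) (S : Finset G) (h : G → F) (x : G) :
    (cayleyOp F S ^ p ^ k) h x = ∑ s ∈ S, h (x + p ^ k • s) := by
  rw [cayleyOp, sum_pow_char_pow_of_commute p k _ translateOp_commute]
  simp [translateOp_pow, translateOp_apply]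

/-! ### Relations between `f` and `g` from powers of the adjacency operator -/

/-- The pair `(f, g)` carries the relation `y - x ∈ S` to itself. -/
def PreservesDiff {G : Type*} [AddCommGroup G] (S : Finset G) (f g : Equiv.Perm G) : Prop :=
  ∀ x y, g y - f x ∈ S ↔ y - x ∈ S

namespace PreservesDiff

variable {G : Type*} [AddCommGroup G] {S : Finset G} {f g : Equiv.Perm G}

theorem swap (hS : ∀ s ∈ S, -s ∈ S) (h : PreservesDiff S f g) : PreservesDiff S g f := by
  have hneg (a b : G) : a - b ∈ S ↔ b - a ∈ S :=
    ⟨fun H => by simpa using hS _ H, fun H => by simpa using hS _ H⟩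
  intro x y
  rw [hneg, h, hneg]

theorem sum_comp {F : Type*} [AddCommMonoid F] (h : PreservesDiff S f g) (u : G → F) (x : G) :
    ∑ s ∈ S, u (g (x + s)) = ∑ s ∈ S, u (f x + s) := by
  refine Finset.sum_bij' (fun s _ => g (x + s) - f x) (fun s _ => g.symm (f x + s) - x)
    (fun s hs => (h _ _).2 (by simpa using hs))
    (fun s hs => (h _ _).1 (by simpa using hs)) ?_ ?_ ?_ <;> simp

theorem cayleyOp_comp {F : Type*} [CommRing F] (h : PreservesDiff S f g) (u : G → F) :
    cayleyOp F S (u ∘ g) = cayleyOp F S u ∘ f :=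
  funext fun x => by simpa [cayleyOp_apply] using h.sum_comp u x

theorem cayleyOp_pow_comp_of_even {F : Type*} [CommRing F] (hS : ∀ s ∈ S, -s ∈ S)
    (h : PreservesDiff S f g) {k : ℕ} (hk : Even k) (u : G → F) :
    (cayleyOp F S ^ k) (u ∘ f) = (cayleyOp F S ^ k) u ∘ f := by
  obtain ⟨k, rfl⟩ := hk
  rw [← two_mul]
  induction k generalizing u with
  | zero => simp
  | succ k ih =>
    rw [mul_add, mul_one, pow_add, pow_two]
    simp only [Module.End.mul_apply]
    rw [(h.swap hS).cayleyOp_comp, h.cayleyOp_comp, ih]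

theorem cayleyOp_pow_comp_of_odd {F : Type*} [CommRing F] (hS : ∀ s ∈ S, -s ∈ S)
    (h : PreservesDiff S f g) {k : ℕ} (hk : Odd k) (u : G → F) :
    (cayleyOp F S ^ k) (u ∘ g) = (cayleyOp F S ^ k) u ∘ f := by
  obtain ⟨k, rfl⟩ := hk
  rw [pow_succ]
  simp only [Module.End.mul_apply]
  rw [h.cayleyOp_comp, h.cayleyOp_pow_comp_of_even hS ⟨k, two_mul k⟩]

theorem sum_comp_char_pow_of_even {F : Type*} [Field F] (p k : ℕ) [Fact p.Prime] [CharP F p]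
    (hS : ∀ s ∈ S, -s ∈ S) (h : PreservesDiff S f g) (hk : Even (p ^ k)) (u : G → F) (x : G) :
    ∑ s ∈ S, u (f (x + p ^ k • s)) = ∑ s ∈ S, u (f x + p ^ k • s) := by
  have := congrFun (h.cayleyOp_pow_comp_of_even hS hk u) x
  simpa [cayleyOp_pow_apply] using this

theorem sum_comp_char_pow_of_odd {F : Type*} [Field F] (p k : ℕ) [Fact p.Prime] [CharP F p]
    (hS : ∀ s ∈ S, -s ∈ S) (h : PreservesDiff S f g) (hk : Odd (p ^ k)) (u : G → F) (x : G) :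
    ∑ s ∈ S, u (g (x + p ^ k • s)) = ∑ s ∈ S, u (f x + p ^ k • s) := by
  have := congrFun (h.cayleyOp_pow_comp_of_odd hS hk u) x
  simpa [cayleyOp_pow_apply] using this

/-- Over a group of odd exponent dividing `n`, a pair of permutations preserving an inverse-closed
connection set consists of automorphisms. -/
theorem self_of_odd {n : ℕ} (hn : Odd n) (hG : ∀ x : G, n • x = 0) (hS : ∀ s ∈ S, -s ∈ S)
    (h : PreservesDiff S f g) : PreservesDiff S f f := by
  classical
  have hφ : 0 < n.totient := Nat.totient_pos.2 hn.pos
  have hpow (x : G) : 2 ^ n.totient • x = x := by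
    have h1 : n ∣ 2 ^ n.totient - 1 :=
      (Nat.modEq_iff_dvd' Nat.one_le_two_pow).1
        (Nat.ModEq.pow_totient (Nat.coprime_two_left.2 hn)).symm
    obtain ⟨c, hc⟩ := h1
    have h2 : 2 ^ n.totient = 1 + c * n := by
      rw [mul_comm, ← hc, Nat.add_sub_cancel' Nat.one_le_two_pow]
    rw [h2, add_nsmul, one_nsmul, mul_nsmul', hG, nsmul_zero, add_zero]
  intro x y
  -- Tested on the indicator of `f y`, each side counts at most one `s ∈ S`, so equality mod 2
  -- already decides membership.
  have key := h.sum_comp_char_pow_of_even (F := ZMod 2) 2 n.totient hS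
    ((even_two).pow_of_ne_zero hφ.ne') (Pi.single (f y) 1) x
  simp only [hpow, Pi.single_apply, Finset.sum_boole, f.injective.eq_iff] at key
  have h1 (a b : G) : Finset.filter (fun s => a + s = b) S = if b - a ∈ S then {b - a} else ∅ := by
    ext s
    have : a + s = b ↔ s = b - a := by rw [eq_sub_iff_add_eq, add_comm]
    split_ifs with hs <;> simp [this] <;> grind
  rw [h1, h1] at key
  split_ifs at key <;> simp_all
end PreservesDiff

/-! ### Twins in circulant graphs, and odd order -/

theorem circulantGraph_adj_iff {G : Type*} [AddCommGroup G] {S : Set G} (h0 : 0 ∉ S)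
    (hS : ∀ s ∈ S, -s ∈ S) (x y : G) : (SimpleGraph.circulantGraph S).Adj x y ↔ y - x ∈ S := by
  have hneg : x - y ∈ S ↔ y - x ∈ S :=
    ⟨fun H => by simpa using hS _ H, fun H => by simpa using hS _ H⟩
  rw [SimpleGraph.circulantGraph_adj, hneg, or_self, and_iff_right_iff_imp]
  rintro H rfl
  exact h0 (by simpa using H)

/-- A set that is invariant under a nonzero translation gives a circulant graph with twins. -/
theorem eq_zero_of_isTwinFree {G : Type*} [AddCommGroup G] {S : Set G} (h0 : 0 ∉ S)
    (hS : ∀ s ∈ S, -s ∈ S) (ht : (SimpleGraph.circulantGraph S).IsTwinFree) {t : G}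
    (h : ∀ s, s + t ∈ S ↔ s ∈ S) : t = 0 := by
  by_contra hne
  refine ht 0 t (Ne.symm hne) (Set.ext fun y => ?_)
  simp only [SimpleGraph.mem_neighborSet, circulantGraph_adj_iff h0 hS]
  rw [← h (y - t)]
  simp

theorem isTwinFree_of_forall {G : Type*} [AddCommGroup G] {S : Set G} (h0 : 0 ∉ S)
    (hS : ∀ s ∈ S, -s ∈ S) (h : ∀ t, (∀ s ∈ S, s + t ∈ S) → t = 0) :
    (SimpleGraph.circulantGraph S).IsTwinFree := by
  intro u v huv heq
  refine huv (sub_eq_zero.1 (h (u - v) fun s hs => ?_))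
  have h1 : s + u ∈ (SimpleGraph.circulantGraph S).neighborSet u := by
    rw [SimpleGraph.mem_neighborSet, circulantGraph_adj_iff h0 hS]
    simpa using hs
  rw [heq, SimpleGraph.mem_neighborSet, circulantGraph_adj_iff h0 hS] at h1
  rwa [← add_sub_assoc]

theorem preservesDiff_of_isTwoFoldAut {G : Type*} [AddCommGroup G] {S : Finset G}
    (h0 : 0 ∉ (S : Set G)) (hS : ∀ s ∈ (S : Set G), -s ∈ (S : Set G)) {f g : Equiv.Perm G}
    (h : (SimpleGraph.circulantGraph (S : Set G)).IsTwoFoldAut f g) : PreservesDiff S f g := by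
  intro x y
  simpa only [circulantGraph_adj_iff h0 hS, Finset.mem_coe] using h x y

theorem not_isNontriviallyUnstable_of_forall_preservesDiff {G : Type*} [AddCommGroup G] [Finite G]
    {S : Finset G} (h0 : 0 ∉ (S : Set G)) (hS : ∀ s ∈ (S : Set G), -s ∈ (S : Set G))
    (h : (SimpleGraph.circulantGraph (S : Set G)).Connected →
      ¬ (SimpleGraph.circulantGraph (S : Set G)).IsBipartite →
      (SimpleGraph.circulantGraph (S : Set G)).IsTwinFree →
      ∀ f g : Equiv.Perm G, PreservesDiff S f g → f = g) :
    ¬ (SimpleGraph.circulantGraph (S : Set G)).IsNontriviallyUnstable := by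
  rintro ⟨hc, hb, ht, hu⟩
  exact SimpleGraph.not_isUnstable_of_forall_isTwoFoldAut hc hb
    (fun f g hfg => h hc hb ht f g (preservesDiff_of_isTwoFoldAut h0 hS hfg)) hu

theorem not_isNontriviallyUnstable_of_odd {n : ℕ} (hn : Odd n) {S : Finset (ZMod n)}
    (h0 : 0 ∉ (S : Set (ZMod n)))
    (hS : ∀ s ∈ (S : Set (ZMod n)), -s ∈ (S : Set (ZMod n))) :
    ¬ (SimpleGraph.circulantGraph (S : Set (ZMod n))).IsNontriviallyUnstable := by
  have : NeZero n := ⟨hn.pos.ne'⟩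
  refine not_isNontriviallyUnstable_of_forall_preservesDiff h0 hS fun _ _ ht f g hfg => ?_
  have hff := hfg.self_of_odd hn (by simp) hS
  -- Comparing the pairs `(f, g)` and `(f, f)` at `x = f⁻¹ (f y - s)` shows that `S` is invariant
  -- under translation by `g y - f y`.
  refine Equiv.ext fun y => (sub_eq_zero.1 (eq_zero_of_isTwinFree h0 hS ht fun s => ?_)).symm
  have h1 := hfg (f.symm (f y - s)) y
  have h2 := hff (f.symm (f y - s)) y
  simp only [Equiv.apply_symm_apply, sub_sub_cancel] at h1 h2
  simp only [Finset.mem_coe]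
  rw [h2, ← h1]
  congr! 1
  abel

/-! ### Interchanging two Cayley relations on `ZMod p` -/

/-- When `p ^ 2` does not divide the order, `zpowers a` is itself a Sylow subgroup, and Sylow
subgroups are conjugate. -/
theorem exists_conj_mem_zpowers {Γ : Type*} [Group Γ] [Finite Γ] {p : ℕ} [hp : Fact p.Prime]
    (hΓ : ¬ p ^ 2 ∣ Nat.card Γ) {a b : Γ} (ha : orderOf a = p) (hb : orderOf b = p) :
    ∃ g : Γ, g * b * g⁻¹ ∈ Subgroup.zpowers a := by
  have isP {c : Γ} (hc : orderOf c = p) : IsPGroup p (Subgroup.zpowers c) :=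
    IsPGroup.of_card (n := 1) (by rw [Nat.card_zpowers, hc, pow_one])
  obtain ⟨P, hP⟩ := (isP ha).exists_le_sylow
  obtain ⟨Q, hQ⟩ := (isP hb).exists_le_sylow
  obtain ⟨g, rfl⟩ := MulAction.exists_smul_eq Γ Q P
  refine ⟨g, ?_⟩
  have hmem : g * b * g⁻¹ ∈ ((g • Q : Sylow p Γ) : Subgroup Γ) := by
    rw [Sylow.coe_subgroup_smul]
    exact Subgroup.smul_mem_pointwise_smul _ (MulAut.conj g) _ (hQ (Subgroup.mem_zpowers b))
  obtain ⟨k, hk⟩ := IsPGroup.iff_card.1 (g • Q : Sylow p Γ).2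
  have hk1 : k ≤ 1 := by
    by_contra! hlt
    exact hΓ ((pow_dvd_pow p hlt).trans (hk ▸ Subgroup.card_subgroup_dvd_card _))
  have hle : Nat.card (g • Q : Sylow p Γ) ≤ Nat.card (Subgroup.zpowers a) := by
    rw [Nat.card_zpowers, ha]
    exact hk.trans_le ((Nat.pow_le_pow_right hp.out.pos hk1).trans_eq (pow_one p))
  rwa [Subgroup.eq_of_le_of_card_ge hP hle]

theorem not_sq_dvd_card_subgroup_perm {p : ℕ} [hp : Fact p.Prime]
    (Γ : Subgroup (Equiv.Perm (ZMod p))) : ¬ p ^ 2 ∣ Nat.card Γ := by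
  intro h
  have h1 := h.trans (Subgroup.card_subgroup_dvd_card Γ)
  rw [Nat.card_perm, Nat.card_zmod, ← Nat.mul_factorial_pred hp.out.ne_zero, pow_two] at h1
  have h2 := (hp.out.dvd_factorial).1 (Nat.dvd_of_mul_dvd_mul_left hp.out.pos h1)
  have := hp.out.pos
  lia

/-- The permutations of an additive group that preserve the two Cayley relations given by a pair of
connection sets. -/
def diffStabilizer {G : Type*} [AddCommGroup G] (D₀ D₁ : Set G) : Subgroup (Equiv.Perm G) where
  carrier := {g | ∀ x y, (g y - g x ∈ D₀ ↔ y - x ∈ D₀) ∧ (g y - g x ∈ D₁ ↔ y - x ∈ D₁)}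
  one_mem' x y := by simp
  mul_mem' {a b} ha hb x y := by
    simp only [Equiv.Perm.mul_apply]
    exact ⟨(ha _ _).1.trans (hb _ _).1, (ha _ _).2.trans (hb _ _).2⟩
  inv_mem' {a} ha x y := by
    have := ha (a⁻¹ x) (a⁻¹ y)
    rw [show a (a⁻¹ x) = x from a.apply_symm_apply x,
      show a (a⁻¹ y) = y from a.apply_symm_apply y] at this
    exact ⟨this.1.symm, this.2.symm⟩

theorem addRight_one_pow_apply {R : Type*} [Ring R] (k : ℕ) (x : R) :
    (Equiv.addRight (1 : R) ^ k) x = x + k := by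
  induction k with
  | zero => simp
  | succ k ih => rw [pow_succ', Equiv.Perm.mul_apply, ih]; simp [add_assoc]

theorem orderOf_addRight_one {p : ℕ} [hp : Fact p.Prime] :
    orderOf (Equiv.addRight (1 : ZMod p)) = p := by
  refine orderOf_eq_prime (Equiv.ext fun x => ?_) fun h => ?_
  · simp
  · simpa using DFunLike.congr_fun h (0 : ZMod p)

/-- A permutation of `ZMod p` interchanging two Cayley relations can be replaced by a
multiplication. -/
theorem exists_mul_swap {p : ℕ} [hp : Fact p.Prime] {D₀ D₁ : Set (ZMod p)}
    {h : Equiv.Perm (ZMod p)} (h₀ : ∀ x y, h y - h x ∈ D₁ ↔ y - x ∈ D₀)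
    (h₁ : ∀ x y, h y - h x ∈ D₀ ↔ y - x ∈ D₁) :
    ∃ m : ZMod p, m ≠ 0 ∧ (∀ x, m * x ∈ D₁ ↔ x ∈ D₀) ∧ ∀ x, m * x ∈ D₀ ↔ x ∈ D₁ := by
  let τ : Equiv.Perm (ZMod p) := Equiv.addRight 1
  have hτ : τ ∈ diffStabilizer D₀ D₁ := fun x y => by simp [τ]
  have hτ' : h * τ * h⁻¹ ∈ diffStabilizer D₀ D₁ := fun x y => by
    simp only [Equiv.Perm.mul_apply]
    have := hτ (h⁻¹ x) (h⁻¹ y)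
    have e₀ := h₀ (h⁻¹ x) (h⁻¹ y)
    have e₁ := h₁ (h⁻¹ x) (h⁻¹ y)
    rw [show h (h⁻¹ x) = x from h.apply_symm_apply x,
      show h (h⁻¹ y) = y from h.apply_symm_apply y] at e₀ e₁
    rw [h₀, h₁, this.1, this.2, e₀, e₁]
    exact ⟨Iff.rfl, Iff.rfl⟩
  obtain ⟨g, hg⟩ := exists_conj_mem_zpowers (not_sq_dvd_card_subgroup_perm (diffStabilizer D₀ D₁))
    (a := ⟨τ, hτ⟩) (b := ⟨h * τ * h⁻¹, hτ'⟩)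
    (by rw [Subgroup.orderOf_mk]; exact orderOf_addRight_one)
    (by
      rw [Subgroup.orderOf_mk, ← MulAut.conj_apply, MulEquiv.orderOf_eq]
      exact orderOf_addRight_one)
  obtain ⟨k, hk⟩ := (Submonoid.mem_powers_iff _ _).1 (mem_powers_iff_mem_zpowers.2 hg)
  have hk' : τ ^ k = g.1 * (h * τ * h⁻¹) * g.1⁻¹ := congrArg Subtype.val hk
  -- `r` conjugates the unit translation to its `k`-th power, so it is affine with slope `k`; it
  -- still interchanges the two relations, because `g` preserves both.
  let r : Equiv.Perm (ZMod p) := g.1 * h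
  have hr : r * τ = τ ^ k * r := by
    rw [hk']
    simp only [r]
    group
  have hstep (x : ZMod p) : r (x + 1) = r x + k := by
    have := DFunLike.congr_fun hr x
    simpa [τ, addRight_one_pow_apply] using this
  have hnat (i : ℕ) : r i = r 0 + k * i := by
    induction i with
    | zero => simp
    | succ i ih => push_cast; rw [hstep, ih]; ring
  have hlin (x : ZMod p) : r x = r 0 + k * x := by
    simpa using hnat x.val
  have hdiff (x : ZMod p) : r x - r 0 = k * x := by rw [hlin]; ring
  refine ⟨k, fun h0 => ?_, fun x => ?_, fun x => ?_⟩
  · have := hlin 1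
    rw [h0, zero_mul, add_zero] at this
    exact one_ne_zero (r.injective this)
  · rw [← hdiff]
    simp only [r, Equiv.Perm.mul_apply]
    rw [(g.2 _ _).2, h₀, sub_zero]
  · rw [← hdiff]
    simp only [r, Equiv.Perm.mul_apply]
    rw [(g.2 _ _).1, h₁, sub_zero]

/-- For `p ≡ 3 [MOD 4]`, distinct inverse-closed subsets of `ZMod p` cannot be interchanged by a
permutation acting on differences. -/
theorem eq_of_diff_swap {p : ℕ} [hp : Fact p.Prime] (hp4 : p % 4 = 3) {D₀ D₁ : Set (ZMod p)}
    (hD₁ : ∀ d ∈ D₁, -d ∈ D₁) {h : Equiv.Perm (ZMod p)}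
    (h₀ : ∀ x y, h y - h x ∈ D₁ ↔ y - x ∈ D₀)
    (h₁ : ∀ x y, h y - h x ∈ D₀ ↔ y - x ∈ D₁) : D₀ = D₁ := by
  obtain ⟨m, hm, hm₀, hm₁⟩ := exists_mul_swap h₀ h₁
  have hodd (k : ℕ) (x : ZMod p) : m ^ (2 * k + 1) * x ∈ D₁ ↔ x ∈ D₀ := by
    induction k with
    | zero => simpa using hm₀ x
    | succ k ih => 
      rw [show m ^ (2 * (k + 1) + 1) * x = m * (m * (m ^ (2 * k + 1) * x)) by ring, hm₀, hm₁]
      exact ih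
  -- `(p - 1) / 2` is odd, so `m ^ (p / 2) = ±1` also carries `D₀` to `D₁`.
  have hk : p / 2 = 2 * (p / 4) + 1 := by lia
  ext x
  rw [← hodd (p / 4), ← hk]
  rcases ZMod.pow_div_two_eq_neg_one_or_one p hm with h1 | h1
  · rw [h1, one_mul]
  · rw [h1, neg_one_mul]
    exact ⟨fun hx => neg_neg x ▸ hD₁ _ hx, fun hx => hD₁ _ hx⟩

/-! ### Order `2p` with `p ≡ 3` mod 4 -/

namespace PreservesDiff

variable {p : ℕ} [hp : Fact p.Prime] {S : Finset (ZMod 2 × ZMod p)}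
  {f g : Equiv.Perm (ZMod 2 × ZMod p)}

/-- For odd `p`, `p • s` is `0` or `(1, 0)` according to the first coordinate of `s`, so `A ^ p`
over `ZMod p` only sees the sizes of the two layers. -/
theorem sum_comp_prime (hp2 : p ≠ 2) (hS : ∀ s ∈ S, -s ∈ S) (h : PreservesDiff S f g)
    (u : ZMod 2 × ZMod p → ZMod p) (x : ZMod 2 × ZMod p) :
    (S.filter (·.1 = 0)).card * u (g x) + (S.filter (·.1 = 1)).card * u (g (x + (1, 0))) =
      (S.filter (·.1 = 0)).card * u (f x) + (S.filter (·.1 = 1)).card * u (f x + (1, 0)) := by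
  have hodd : Odd p := hp.out.odd_of_ne_two hp2
  have hsum (v : ZMod 2 × ZMod p → ZMod p) : ∑ s ∈ S, v (p • s) =
      (S.filter (·.1 = 0)).card * v 0 + (S.filter (·.1 = 1)).card * v (1, 0) := by
    have hfilter : S.filter (·.1 = 1) = S.filter (¬ ·.1 = 0) := by
      refine Finset.filter_congr fun s _ => ?_
      generalize s.1 = a
      revert a
      decide
    have hp1 : (p : ZMod 2) = 1 := (ZMod.natCast_eq_one_iff_odd).2 hodd
    rw [hfilter, ← Finset.sum_filter_add_sum_filter_not S (·.1 = 0)]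
    congr 1
    · rw [← nsmul_eq_mul, ← Finset.sum_const]
      refine Finset.sum_congr rfl fun s hs => congrArg v ?_
      ext <;> simp [(Finset.mem_filter.1 hs).2]
    · rw [← nsmul_eq_mul, ← Finset.sum_const]
      refine Finset.sum_congr rfl fun s hs => congrArg v ?_
      rw [← hfilter] at hs
      ext <;> simp [(Finset.mem_filter.1 hs).2, hp1]
  have key := h.sum_comp_char_pow_of_odd (F := ZMod p) p 1 hS (by rwa [pow_one]) u x
  simp only [pow_one] at key
  rw [hsum fun t => u (g (x + t)), hsum fun t => u (f x + t)] at key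
  simpa using key

/-- Doubling kills the first coordinate, and as `(1, d) ∉ S` only `s = (0, d)` has `2 • s = (0, 2 *
d)`. The square relation over `ZMod 2` then has an odd term, so `f` moves by some `(0, 2 * s.2)`
along this step; multiples of `2 * d` exhaust `ZMod p`. -/
theorem fst_apply_add_snd (hp2 : p ≠ 2) (hS : ∀ s ∈ S, -s ∈ S) (h : PreservesDiff S f g)
    {d : ZMod p} (hd : d ≠ 0) (hdS : (0, d) ∈ S) (hdS' : (1, d) ∉ S) (x : ZMod 2 × ZMod p)
    (b : ZMod p) : (f (x + (0, b))).1 = (f x).1 := by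
  have h2 : (2 : ZMod p) ≠ 0 := by
    have := (ZMod.natCast_eq_zero_iff 2 p).not.2
      fun hdvd => hp2 ((Nat.prime_dvd_prime_iff_eq hp.out Nat.prime_two).1 hdvd)
    exact_mod_cast this
  have hdouble (s : ZMod 2 × ZMod p) : 2 • s = (0, 2 * s.2) := by
    ext
    · simp [show (2 : ZMod 2) = 0 from rfl]
    · simp
  have hstep (x : ZMod 2 × ZMod p) : (f (x + (0, 2 * d))).1 = (f x).1 := by
    have key := h.sum_comp_char_pow_of_even (F := ZMod 2) 2 1 hS (by decide)
      (Pi.single (f (x + (0, 2 * d))) 1) x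
    have hfilter : S.filter (fun s => x + (0, 2 * s.2) = x + (0, 2 * d)) = {(0, d)} := by
      ext ⟨a, b⟩
      have ha : a = 0 ∨ a = 1 := by revert a; decide
      rcases ha with rfl | rfl <;> simp [h2] <;> grind
    simp only [pow_one, hdouble, Pi.single_apply, f.injective.eq_iff] at key
    rw [Finset.sum_boole, hfilter, Finset.card_singleton, Nat.cast_one] at key
    obtain ⟨s, -, hs⟩ := Finset.exists_ne_zero_of_sum_ne_zero (key ▸ one_ne_zero)
    have hs' : f x + (0, 2 * s.2) = f (x + (0, 2 * d)) := by
      by_contra hne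
      exact hs (if_neg hne)
    rw [← hs']
    simp
  have hiter (k : ℕ) : (f (x + (0, k * (2 * d)))).1 = (f x).1 := by
    induction k with
    | zero => simp [Prod.mk_zero_zero]
    | succ k ih =>
      rw [← ih, ← hstep (x + (0, k * (2 * d)))]
      congr 2
      ext
      · simp
      · simp
        ring
  have := hiter (b / (2 * d)).val
  rwa [ZMod.natCast_zmod_val, div_mul_cancel₀ _ (mul_ne_zero h2 hd)] at this

/-- The first coordinate of `f` factors through a permutation of `ZMod 2`, and every such
permutation is a translation. -/
theorem fst_sub_fst_of_forall {f : Equiv.Perm (ZMod 2 × ZMod p)}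
    (hf : ∀ x b, (f (x + (0, b))).1 = (f x).1) (x y : ZMod 2 × ZMod p) :
    (f y).1 - (f x).1 = y.1 - x.1 := by
  have hdep (x : ZMod 2 × ZMod p) : (f x).1 = (f (x.1, 0)).1 := by
    rw [← hf (x.1, 0) x.2]
    simp
  have hne : (f (1, 0)).1 ≠ (f (0, 0)).1 := by
    intro heq
    have hall (x : ZMod 2 × ZMod p) : (f x).1 = (f (0, 0)).1 := by
      rw [hdep]
      have hx : x.1 = 0 ∨ x.1 = 1 := by generalize x.1 = a; revert a; decide
      rcases hx with hx | hx <;> rw [hx]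
      exact heq
    have := hall (f.symm ((f (0, 0)).1 + 1, 0))
    simp at this
  rw [hdep x, hdep y]
  have hx : x.1 = 0 ∨ x.1 = 1 := by generalize x.1 = a; revert a; decide
  have hy : y.1 = 0 ∨ y.1 = 1 := by generalize y.1 = a; revert a; decide
  have hF : ∀ a b : ZMod 2, a ≠ b → a - b = 1 := by decide
  have hF' : ∀ a b : ZMod 2, a ≠ b → b - a = 1 := by decide
  rcases hx with hx | hx <;> rcases hy with hy | hy <;> rw [hx, hy]
  · simp
  · rw [hF _ _ hne]; rfl
  · rw [hF' _ _ hne]; rfl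
  · simp

end PreservesDiff

/-- If the two layers of `S` have equally many elements and no nonzero translation preserves `S`,
then some element of the zero layer has no partner in the other layer. -/
theorem exists_mem_not_mem_of_card_eq {p : ℕ} {S : Finset (ZMod 2 × ZMod p)}
    (hcard : (S.filter (·.1 = 0)).card = (S.filter (·.1 = 1)).card)
    (htwin : ∀ t, (∀ s, s + t ∈ S ↔ s ∈ S) → t = 0) : ∃ d, (0, d) ∈ S ∧ (1, d) ∉ S := by
  by_contra! hall
  have hsub : (S.filter (·.1 = 0)).image (· + (1, 0)) ⊆ S.filter (·.1 = 1) := by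
    rintro _ ht
    obtain ⟨⟨a, d⟩, hs, rfl⟩ := Finset.mem_image.1 ht
    obtain ⟨hs, rfl⟩ := Finset.mem_filter.1 hs
    simpa using hall d hs
  -- Equal sizes upgrade the inclusion of layers to equality, so `(1, 0)` would preserve `S`.
  have heq := Finset.eq_of_subset_of_card_le hsub
    (by rw [Finset.card_image_of_injective _ (add_left_injective _), hcard])
  have hiff (d : ZMod p) : (1, d) ∈ S ↔ (0, d) ∈ S := by
    refine ⟨fun hd => ?_, hall d⟩
    have : (1, d) ∈ (S.filter (·.1 = 0)).image (· + (1, 0)) := by rw [heq]; simpa using hd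
    obtain ⟨⟨a, d'⟩, hs, hs'⟩ := Finset.mem_image.1 this
    obtain ⟨hs, rfl⟩ := Finset.mem_filter.1 hs
    simp at hs'
    exact hs' ▸ hs
  have := htwin (1, 0) fun ⟨a, d⟩ => by
    have ha : a = 0 ∨ a = 1 := by revert a; decide
    rcases ha with rfl | rfl
    · simpa using hiff d
    · simpa [show (1 + 1 : ZMod 2) = 0 from rfl] using (hiff d).symm
  simp at this

theorem PreservesDiff.eq_of_three_mod_four {p : ℕ} [hp : Fact p.Prime] (hp4 : p % 4 = 3)
    {S : Finset (ZMod 2 × ZMod p)} {f g : Equiv.Perm (ZMod 2 × ZMod p)} (h0 : 0 ∉ S)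
    (hS : ∀ s ∈ S, -s ∈ S) (hne : ∃ s ∈ S, s.1 = 0)
    (htwin : ∀ t, (∀ s, s + t ∈ S ↔ s ∈ S) → t = 0) (h : PreservesDiff S f g) : f = g := by
  have hp2 : p ≠ 2 := by rintro rfl; simp at hp4
  have hw : ((1 : ZMod 2), (0 : ZMod p)) ≠ 0 := by simp
  have hww : ((1 : ZMod 2), (0 : ZMod p)) + (1, 0) = 0 := by
    ext
    · rfl
    · simp
  have key := h.sum_comp_prime hp2 hS
  set k₀ := (S.filter (·.1 = 0)).card with hk₀
  set k₁ := (S.filter (·.1 = 1)).card with hk₁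
  have hk₀pos : 0 < k₀ := by
    obtain ⟨s, hs, hs0⟩ := hne
    exact Finset.card_pos.2 ⟨s, by simp [hs, hs0]⟩
  have hinj (a : ZMod 2) : Set.InjOn Prod.snd (S.filter (·.1 = a) : Set (ZMod 2 × ZMod p)) := by
    intro s hs t ht hst
    rw [Finset.mem_coe, Finset.mem_filter] at hs ht
    exact Prod.ext (hs.2.trans ht.2.symm) hst
  have hk₀lt : k₀ < p := by
    rw [hk₀, ← Finset.card_image_of_injOn (hinj 0)]
    refine (Finset.card_lt_univ_of_notMem (x := 0) fun hmem => ?_).trans_eq (ZMod.card p)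
    obtain ⟨s, hs, hs0⟩ := Finset.mem_image.1 hmem
    obtain ⟨hs, hs1⟩ := Finset.mem_filter.1 hs
    exact h0 ((Prod.ext hs1 hs0 : s = 0) ▸ hs)
  have hk₁le : k₁ ≤ p := by
    rw [hk₁, ← Finset.card_image_of_injOn (hinj 1)]
    exact (Finset.card_le_univ _).trans_eq (ZMod.card p)
  have hk₀ne : (k₀ : ZMod p) ≠ 0 := fun hz =>
    Nat.not_dvd_of_pos_of_lt hk₀pos hk₀lt ((ZMod.natCast_eq_zero_iff _ _).1 hz)
  have hcases (x : ZMod 2 × ZMod p) (hx : f x ≠ g x) :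
      f x + (1, 0) = g x ∧ (k₀ : ZMod p) = k₁ := by
    -- On the indicator of `g x` the left side is `k₀ ≠ 0`; since `f x ≠ g x`, only the `k₁` term on
    -- the right can match it.
    have := key (Pi.single (g x) 1) x
    simp only [Pi.single_apply, g.injective.eq_iff, add_eq_left, hw, hx, if_false, if_true,
      mul_zero, mul_one, add_zero, zero_add] at this
    split_ifs at this with hfg
    · exact ⟨hfg, by simpa using this⟩
    · exact absurd (by simpa using this) hk₀ne
  by_contra hfg
  obtain ⟨x₀, hx₀⟩ : ∃ x, f x ≠ g x := by
    by_contra! hall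
    exact hfg (Equiv.ext hall)
  obtain ⟨hx₀', hkk⟩ := hcases x₀ hx₀
  -- The congruence is an equality because `0 < k₀ < p` and `k₁ ≤ p`; `k₁ = p` would force `p ∣ k₀`.
  have hk : k₀ = k₁ := by
    have hmod := (ZMod.natCast_eq_natCast_iff' _ _ _).1 hkk
    rcases hk₁le.eq_or_lt with hk₁p | hk₁p
    · rw [hk₁p, Nat.mod_self, Nat.mod_eq_of_lt hk₀lt] at hmod
      lia
    · rwa [Nat.mod_eq_of_lt hk₀lt, Nat.mod_eq_of_lt hk₁p] at hmod
  obtain ⟨d, hd, hd'⟩ := exists_mem_not_mem_of_card_eq hk htwin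
  have hd0 : d ≠ 0 := by rintro rfl; exact h0 hd
  have hf := fst_sub_fst_of_forall (h.fst_apply_add_snd hp2 hS hd0 hd hd')
  have hg := fst_sub_fst_of_forall ((h.swap hS).fst_apply_add_snd hp2 hS hd0 hd hd')
  -- On first coordinates `f` and `g` are translations that differ at `x₀`, hence everywhere.
  have hgf (x : ZMod 2 × ZMod p) : g x = f x + (1, 0) := by
    refine ((hcases x fun heq => ?_).1).symm
    have h1 := hf x₀ x
    have h2 := hg x₀ x
    rw [← hx₀', ← heq, Prod.fst_add, ← h1] at h2
    simp at h2
  have hfw (x : ZMod 2 × ZMod p) : f (x + (1, 0)) = f x + (1, 0) := by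
    have := key (Pi.single (f x) 1) x
    simp only [hgf, Pi.single_apply, add_eq_left, hw, if_false, if_true, mul_zero, mul_one,
      add_zero, zero_add] at this
    split_ifs at this with hx
    · rw [← hx, add_assoc, hww, add_zero]
    · exact absurd (by simpa using this.symm) hk₀ne
  let c := (f (0, 0)).1
  have hc (b : ZMod p) : f (0, b) = (c, (f (0, b)).2) := by
    refine Prod.ext ?_ rfl
    have := hf (0, 0) (0, b)
    simpa [sub_eq_zero] using this
  let r : Equiv.Perm (ZMod p) := Equiv.ofBijective (fun b => (f (0, b)).2)
    (Finite.injective_iff_bijective.1 fun b b' hbb => by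
      have : f (0, b) = f (0, b') := by rw [hc b, hc b']; exact Prod.ext rfl hbb
      simpa using f.injective this)
  have hr (b : ZMod p) : f (0, b) = (c, r b) := hc b
  have hD := eq_of_diff_swap hp4 (D₀ := {b | (0, b) ∈ S}) (D₁ := {b | (1, b) ∈ S}) (h := r)
    (fun b hb => by simpa using hS _ hb)
    (fun b b' => by
      have := h (0, b) (0, b')
      rw [hgf, hr, hr] at this
      simpa using this)
    (fun b b' => by
      have := h (0, b) ((0, b') + (1, 0))
      rw [hgf, hfw, hr, hr, add_assoc, hww] at this
      simpa using this)
  exact hd' ((Set.ext_iff.1 hD d).1 hd)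

/-! ### Stable even orders: 2, 4 and `2p` -/

theorem exists_mem_even_of_not_isBipartite {n : ℕ} (hn : 2 ∣ n) {S : Set (ZMod n)} (h0 : 0 ∉ S)
    (hS : ∀ s ∈ S, -s ∈ S) (hb : ¬ (SimpleGraph.circulantGraph S).IsBipartite) :
    ∃ s ∈ S, ZMod.castHom hn (ZMod 2) s = 0 := by
  by_contra! hall
  refine hb (SimpleGraph.Coloring.colorable (α := ZMod 2)
    (SimpleGraph.Coloring.mk (ZMod.castHom hn (ZMod 2)) fun {x y} hxy heq => ?_))
  rw [circulantGraph_adj_iff h0 hS] at hxy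
  exact hall _ hxy (by rw [map_sub, heq, sub_self])

theorem exists_mem_odd_of_connected {n : ℕ} (hn : 2 ∣ n) {S : Set (ZMod n)} (h0 : 0 ∉ S)
    (hS : ∀ s ∈ S, -s ∈ S) (hc : (SimpleGraph.circulantGraph S).Connected) :
    ∃ s ∈ S, ZMod.castHom hn (ZMod 2) s ≠ 0 := by
  by_contra! hall
  have (x y : ZMod n) : ZMod.castHom hn (ZMod 2) x = ZMod.castHom hn (ZMod 2) y := by
    obtain ⟨w⟩ := hc.preconnected x y
    induction w with
    | nil => rfl
    | cons hadj _ ih =>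
      rw [circulantGraph_adj_iff h0 hS] at hadj
      rw [← ih]
      exact (sub_eq_zero.1 ((map_sub _ _ _).symm.trans (hall _ hadj))).symm
  exact one_ne_zero (by simpa only [map_one, map_zero] using this 1 0)

theorem not_isNontriviallyUnstable_two {S : Finset (ZMod 2)} (h0 : 0 ∉ (S : Set (ZMod 2)))
    (hS : ∀ s ∈ (S : Set (ZMod 2)), -s ∈ (S : Set (ZMod 2))) :
    ¬ (SimpleGraph.circulantGraph (S : Set (ZMod 2))).IsNontriviallyUnstable := by
  rintro ⟨-, hb, -⟩
  obtain ⟨s, hs, hs0⟩ := exists_mem_even_of_not_isBipartite dvd_rfl h0 hS hb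
  rw [ZMod.castHom_self, RingHom.id_apply] at hs0
  exact h0 (hs0 ▸ hs)

/-- Connectedness and nonbipartiteness leave only the complete graph, where `g x - f x ∉ S` means `f
x = g x`. -/
theorem not_isNontriviallyUnstable_four {S : Finset (ZMod 4)} (h0 : 0 ∉ (S : Set (ZMod 4)))
    (hS : ∀ s ∈ (S : Set (ZMod 4)), -s ∈ (S : Set (ZMod 4))) :
    ¬ (SimpleGraph.circulantGraph (S : Set (ZMod 4))).IsNontriviallyUnstable := by
  refine not_isNontriviallyUnstable_of_forall_preservesDiff h0 hS fun hc hb _ f g hfg => ?_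
  obtain ⟨s, hs, hs0⟩ := exists_mem_even_of_not_isBipartite (by decide) h0 hS hb
  obtain ⟨t, ht, ht0⟩ := exists_mem_odd_of_connected (by decide) h0 hS hc
  have hneg := hS t ht
  have heven : ∀ s : ZMod 4, ZMod.castHom (by decide) (ZMod 2) s = 0 → s = 0 ∨ s = 2 := by decide
  have hodd : ∀ t x : ZMod 4, ZMod.castHom (by decide) (ZMod 2) t ≠ 0 → x ≠ 0 → x ≠ 2 →
      x = t ∨ x = -t := by decide
  have h2 : (2 : ZMod 4) ∈ (S : Set (ZMod 4)) := by
    rcases heven s hs0 with rfl | rfl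
    · exact absurd hs h0
    · exact hs
  have hmem (x : ZMod 4) : x ∈ S ↔ x ≠ 0 := by
    refine ⟨fun hx hx0 => h0 (hx0 ▸ hx), fun hx0 => ?_⟩
    by_cases hx2 : x = 2
    · exact hx2 ▸ h2
    · rcases hodd t x ht0 hx0 hx2 with rfl | rfl
      · exact ht
      · exact hneg
  refine Equiv.ext fun x => ?_
  have := hfg x x
  exact (sub_eq_zero.1 (by simpa [hmem] using this)).symm

theorem PreservesDiff.map {G H : Type*} [AddCommGroup G] [AddCommGroup H] (e : G ≃+ H)
    {S : Finset G} {f g : Equiv.Perm G} (h : PreservesDiff S f g) :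
    PreservesDiff (S.map e.toEquiv.toEmbedding) (e.toEquiv.permCongr f) (e.toEquiv.permCongr g) := by
  intro x y
  rw [Finset.mem_map_equiv, Finset.mem_map_equiv]
  simpa [Equiv.permCongr_apply] using h (e.symm x) (e.symm y)

theorem not_isNontriviallyUnstable_two_mul_prime {p : ℕ} (hp : p.Prime) (hp4 : p % 4 = 3)
    {S : Finset (ZMod (2 * p))} (h0 : 0 ∉ (S : Set (ZMod (2 * p))))
    (hS : ∀ s ∈ (S : Set (ZMod (2 * p))), -s ∈ (S : Set (ZMod (2 * p)))) :
    ¬ (SimpleGraph.circulantGraph (S : Set (ZMod (2 * p)))).IsNontriviallyUnstable := by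
  have : Fact p.Prime := ⟨hp⟩
  have : NeZero (2 * p) := ⟨mul_ne_zero two_ne_zero hp.ne_zero⟩
  refine not_isNontriviallyUnstable_of_forall_preservesDiff h0 hS fun _ hb ht f g hfg => ?_
  have hcop : Nat.Coprime 2 p := Nat.coprime_two_left.2 (Nat.odd_iff.2 (by lia))
  let e := (ZMod.chineseRemainder hcop).toAddEquiv
  have hmem (x : ZMod 2 × ZMod p) : x ∈ S.map e.toEquiv.toEmbedding ↔ e.symm x ∈ S :=
    Finset.mem_map_equiv
  obtain ⟨s, hs, hs0⟩ := exists_mem_even_of_not_isBipartite ⟨p, rfl⟩ h0 hS hb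
  have key := (hfg.map e).eq_of_three_mod_four hp4
    (by rw [hmem, map_zero]; exact h0)
    (fun s hs => by
      rw [hmem] at hs ⊢
      rw [map_neg]
      exact hS _ hs)
    ⟨e s, by rw [hmem, e.symm_apply_apply]; exact hs,
      hs0 ▸ DFunLike.congr_fun (Subsingleton.elim
        ((RingHom.fst _ _).comp (ZMod.chineseRemainder hcop).toRingHom)
        (ZMod.castHom ⟨p, rfl⟩ (ZMod 2))) s⟩
    (fun t htS => e.symm.map_eq_zero_iff.1 (eq_zero_of_isTwinFree h0 hS ht fun s => by
      have := htS (e s)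
      rw [hmem, hmem, map_add, e.symm_apply_apply] at this
      exact this))
  exact e.toEquiv.permCongr.injective key

/-! ### Nontrivially unstable examples -/

theorem circulantGraph_connected_of_one_mem {n : ℕ} [NeZero n] {S : Set (ZMod n)} (h0 : 0 ∉ S)
    (hS : ∀ s ∈ S, -s ∈ S) (h1 : 1 ∈ S) : (SimpleGraph.circulantGraph S).Connected := by
  have hnat (k : ℕ) : (SimpleGraph.circulantGraph S).Reachable 0 (k : ZMod n) := by
    induction k with
    | zero => simp
    | succ k ih =>
      refine ih.trans (SimpleGraph.Adj.reachable ?_)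
      rw [circulantGraph_adj_iff h0 hS]
      simpa using h1
  have h (x : ZMod n) : (SimpleGraph.circulantGraph S).Reachable 0 x :=
    ZMod.natCast_zmod_val x ▸ hnat x.val
  exact ⟨fun x y => (h x).symm.trans (h y)⟩

theorem circulantGraph_not_isBipartite_of_one_mem {n : ℕ} [NeZero n] (hn : 2 ∣ n)
    {S : Set (ZMod n)} (h0 : 0 ∉ S) (hS : ∀ s ∈ S, -s ∈ S) (h1 : 1 ∈ S) {e : ZMod n} (he : e ∈ S)
    (heven : ZMod.castHom hn (ZMod 2) e = 0) : ¬ (SimpleGraph.circulantGraph S).IsBipartite := by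
  rintro ⟨c⟩
  have hne (x s : ZMod n) (hs : s ∈ S) : c (x + s) ≠ c x :=
    (c.valid ((circulantGraph_adj_iff h0 hS _ _).2 (by simpa using hs))).symm
  have htwo (a b d : Fin 2) (hab : a ≠ b) (hbd : b ≠ d) : a = d := by lia
  have hiter (k : ℕ) : c ((2 * k : ℕ) : ZMod n) = c 0 := by
    induction k with
    | zero => simp
    | succ k ih =>
      rw [← ih]
      have e1 : ((2 * (k + 1) : ℕ) : ZMod n) = ((2 * k : ℕ) : ZMod n) + 1 + 1 := by
        push_cast
        ring
      rw [e1]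
      exact htwo _ _ _ (hne _ 1 h1) (hne _ 1 h1)
  have hval : 2 ∣ e.val := by
    rw [← ZMod.natCast_zmod_val e, map_natCast] at heven
    exact (ZMod.natCast_eq_zero_iff _ _).1 heven
  obtain ⟨k, hk⟩ := hval
  refine hne 0 e he ?_
  rw [zero_add, ← hiter k, ← hk, ZMod.natCast_zmod_val]

theorem ZMod.natCast_ne_zero_of_lt {n k : ℕ} (hk : 0 < k) (hkn : k < n) : (k : ZMod n) ≠ 0 :=
  fun h => Nat.not_dvd_of_pos_of_lt hk hkn ((ZMod.natCast_eq_zero_iff _ _).1 h)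

/-- An even translation preserving `S` maps `1` and `-1` into `{1, -1}`; if `t ≠ 0`, then `t = -2`
and `t = 2`, so `4 = 0`. -/
theorem eq_zero_of_even_translation {n : ℕ} (hn : 2 ∣ n) (hn4 : 4 < n) {S : Set (ZMod n)}
    (h1 : 1 ∈ S) (hneg1 : -1 ∈ S)
    (hodd : ∀ s ∈ S, ZMod.castHom hn (ZMod 2) s ≠ 0 → s = 1 ∨ s = -1) {t : ZMod n}
    (ht : ∀ s ∈ S, s + t ∈ S) (heven : ZMod.castHom hn (ZMod 2) t = 0) : t = 0 := by
  have h4 : (4 : ZMod n) ≠ 0 := by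
    exact_mod_cast ZMod.natCast_ne_zero_of_lt (by norm_num : 0 < 4) hn4
  have ha := hodd _ (ht 1 h1) (by rw [map_add, heven, map_one, add_zero]; exact one_ne_zero)
  have hb := hodd _ (ht (-1) hneg1)
    (by rw [map_add, heven, map_neg, map_one, add_zero]; exact neg_ne_zero.2 one_ne_zero)
  rcases ha with ha | ha
  · simpa using ha
  · rcases hb with hb | hb
    · exact absurd (by linear_combination ha - hb) h4
    · simpa using hb

theorem isUnstable_of_preservesDiff {G : Type*} [AddCommGroup G] {S : Set G} (h0 : 0 ∉ S)
    (hS : ∀ s ∈ S, -s ∈ S) {f g : Equiv.Perm G} (h : ∀ x y, g y - f x ∈ S ↔ y - x ∈ S)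
    (hfg : f ≠ g) : (SimpleGraph.circulantGraph S).IsUnstable :=
  SimpleGraph.IsTwoFoldAut.isUnstable (f := f) (g := g)
    (fun x y => by rw [circulantGraph_adj_iff h0 hS, circulantGraph_adj_iff h0 hS, h]) hfg

/-- The permutation that translates the elements satisfying a translation-invariant predicate. -/
def translateOn {G : Type*} [AddCommGroup G] (P : G → Prop) [DecidablePred P] (t : G)
    (hP : ∀ x, P (x + t) ↔ P x) : Equiv.Perm G where
  toFun x := if P x then x + t else x
  invFun x := if P x then x - t else x
  left_inv x := by
    by_cases hx : P x <;> simp [hx, hP]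
  right_inv x := by
    have : P (x - t) ↔ P x := by rw [← hP (x - t), sub_add_cancel]
    by_cases hx : P x <;> simp [hx, this]

/-- `S` consists of `±1` and the even residues not divisible by `2 * a`, so its even part is
invariant under `t = 2 * a`. Let `f` translate the evens and `g` the odds by `t`: even differences
change by `±t`, odd ones not at all. -/
theorem exists_isNontriviallyUnstable_two_mul_mul {a b : ℕ} (ha : 2 ≤ a) (hb : 2 ≤ b)
    (hab : 8 ≤ 2 * (a * b)) : ∃ S : Set (ZMod (2 * (a * b))), 0 ∉ S ∧ (∀ s ∈ S, -s ∈ S) ∧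
      (SimpleGraph.circulantGraph S).IsNontriviallyUnstable := by
  have : NeZero (2 * (a * b)) := ⟨by lia⟩
  have hn : 2 ∣ 2 * (a * b) := ⟨_, rfl⟩
  have hna : 2 * a ∣ 2 * (a * b) := ⟨b, by ring⟩
  let π := ZMod.castHom hn (ZMod 2)
  let ρ := ZMod.castHom hna (ZMod (2 * a))
  let S : Set (ZMod (2 * (a * b))) := {x | x = 1 ∨ x = -1 ∨ (π x = 0 ∧ ρ x ≠ 0)}
  let t : ZMod (2 * (a * b)) := ((2 * a : ℕ) : ZMod (2 * (a * b)))
  have hπt : π t = 0 := by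
    rw [map_natCast]
    exact (ZMod.natCast_eq_zero_iff _ _).2 ⟨a, rfl⟩
  have hρt : ρ t = 0 := by rw [map_natCast, ZMod.natCast_self]
  have ht : t ≠ 0 := ZMod.natCast_ne_zero_of_lt (by lia) (by nlinarith)
  have hmem (x : ZMod (2 * (a * b))) : x ∈ S ↔ x = 1 ∨ x = -1 ∨ (π x = 0 ∧ ρ x ≠ 0) := Iff.rfl
  have hπ1 : π 1 ≠ 0 := by rw [map_one]; exact one_ne_zero
  have hπn1 : π (-1) ≠ 0 := by rw [map_neg, map_one]; exact neg_ne_zero.2 one_ne_zero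
  have heven (x : ZMod (2 * (a * b))) (hx : π x = 0) : x ∈ S ↔ ρ x ≠ 0 := by
    rw [hmem]
    refine ⟨?_, fun h => Or.inr (Or.inr ⟨hx, h⟩)⟩
    rintro (rfl | rfl | h)
    · exact absurd hx hπ1
    · exact absurd hx hπn1
    · exact h.2
  have hodd (x : ZMod (2 * (a * b))) (hxS : x ∈ S) (hx : π x ≠ 0) : x = 1 ∨ x = -1 := by
    rcases (hmem x).1 hxS with h | h | h
    · exact Or.inl h
    · exact Or.inr h
    · exact absurd h.1 hx
  have hadd (x : ZMod (2 * (a * b))) (hx : π x = 0) : x + t ∈ S ↔ x ∈ S := by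
    rw [heven x hx, heven (x + t) (by rw [map_add, hx, hπt, add_zero]), map_add, hρt, add_zero]
  have h1 : (1 : ZMod (2 * (a * b))) ∈ S := Or.inl rfl
  have hneg1 : (-1 : ZMod (2 * (a * b))) ∈ S := Or.inr (Or.inl rfl)
  have h0 : (0 : ZMod (2 * (a * b))) ∉ S := by rw [heven 0 (map_zero π), map_zero]; simp
  have hS : ∀ s ∈ S, -s ∈ S := by
    rintro s (rfl | rfl | ⟨h, h'⟩)
    · exact hneg1
    · rw [neg_neg]; exact h1
    · exact Or.inr (Or.inr ⟨by rw [map_neg, h, neg_zero], by rw [map_neg]; exact neg_ne_zero.2 h'⟩)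
  have hπ2 : π 2 = 0 := by
    rw [map_ofNat]
    rfl
  have h2 : (2 : ZMod (2 * (a * b))) ∈ S := by
    rw [heven 2 hπ2, map_ofNat]
    exact_mod_cast ZMod.natCast_ne_zero_of_lt (n := 2 * a) (by norm_num : 0 < 2) (by lia)
  refine ⟨S, h0, hS, circulantGraph_connected_of_one_mem h0 hS h1,
    circulantGraph_not_isBipartite_of_one_mem hn h0 hS h1 h2 hπ2,
    isTwinFree_of_forall h0 hS fun u hu => ?_, ?_⟩
  · by_cases hπu : π u = 0
    · exact eq_zero_of_even_translation hn (by lia) h1 hneg1 hodd hu hπu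
    · exfalso
      have e1 := hodd _ (hu 2 h2) (by rwa [map_add, hπ2, zero_add])
      have e2 := hodd _ (hu (-2) (hS 2 h2)) (by rwa [map_add, map_neg, hπ2, neg_zero, zero_add])
      have hk (k : ℕ) (hk : 0 < k) (hk8 : k < 8) : (k : ZMod (2 * (a * b))) ≠ 0 :=
        ZMod.natCast_ne_zero_of_lt hk (by lia)
      have hk2 := hk 2 (by norm_num) (by norm_num)
      have hk4 := hk 4 (by norm_num) (by norm_num)
      have hk6 := hk 6 (by norm_num) (by norm_num)
      push_cast at hk2 hk4 hk6
      rcases e1 with e1 | e1 <;> rcases e2 with e2 | e2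
      · exact hk4 (by linear_combination e1 - e2)
      · exact hk2 (by linear_combination e1 - e2)
      · exact hk6 (by linear_combination e1 - e2)
      · exact hk4 (by linear_combination e1 - e2)
  · have hπadd (x : ZMod (2 * (a * b))) : π (x + t) = π x := by rw [map_add, hπt, add_zero]
    let f := translateOn (fun x => π x = 0) t fun x => by rw [hπadd]
    let g := translateOn (fun x => π x ≠ 0) t fun x => by rw [hπadd]
    have hf (x : ZMod (2 * (a * b))) : f x = if π x = 0 then x + t else x := rfl
    have hg (x : ZMod (2 * (a * b))) : g x = if π x ≠ 0 then x + t else x := rfl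
    refine isUnstable_of_preservesDiff h0 hS (f := f) (g := g) (fun x y => ?_) fun hfg => ?_
    · have hsum : ∀ c d : ZMod 2, c ≠ 0 → d ≠ 0 → d - c = 0 := by decide
      rw [hf, hg]
      by_cases hx : π x = 0 <;> by_cases hy : π y = 0 <;> simp only [hx, hy, ne_eq, not_true,
        not_false_iff, if_true, if_false, add_sub_add_right_eq_sub]
      · rw [← hadd (y - (x + t)) (by rw [map_sub, hπadd, hx, hy, sub_zero])]
        congr! 1
        abel
      · rw [← hadd (y - x) (by rw [map_sub]; exact hsum _ _ hx hy)]
        congr! 1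
        abel
    · have := DFunLike.congr_fun hfg (0 : ZMod (2 * (a * b)))
      rw [hf, hg] at this
      simp at this
      exact ht this

/-- With `m ^ 2 = -1` and `w` the involution, the affine map `s ↦ m * s + w` permutes `S = {±1, ±(w
+ m)}`. Hence `f x = m * x` and `g x = m * x + w` form the required pair. -/
theorem exists_isNontriviallyUnstable_two_mul_prime {p : ℕ} (hp : p.Prime) (hp4 : p % 4 = 1) :
    ∃ S : Set (ZMod (2 * p)), 0 ∉ S ∧ (∀ s ∈ S, -s ∈ S) ∧
      (SimpleGraph.circulantGraph S).IsNontriviallyUnstable := by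
  have : Fact p.Prime := ⟨hp⟩
  have : NeZero (2 * p) := ⟨mul_ne_zero two_ne_zero hp.ne_zero⟩
  have hp5 : 5 ≤ p := by
    have := hp.two_le
    lia
  have hn : 2 ∣ 2 * p := ⟨_, rfl⟩
  have hcop : Nat.Coprime 2 p := Nat.coprime_two_left.2 (Nat.odd_iff.2 (by lia))
  let e := ZMod.chineseRemainder hcop
  let π := ZMod.castHom hn (ZMod 2)
  have hπe (x : ZMod (2 * p)) : π x = (e x).1 :=
    DFunLike.congr_fun (Subsingleton.elim π ((RingHom.fst _ _).comp e.toRingHom)) x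
  obtain ⟨r, hr⟩ := ZMod.exists_sq_eq_neg_one_iff.2 (show p % 4 ≠ 3 by lia)
  let m := e.symm (1, r)
  let w := e.symm (1, 0)
  have hm : m * m = -1 := e.injective (by
    rw [map_mul, e.apply_symm_apply, map_neg, map_one]
    exact Prod.ext rfl hr.symm)
  have hmw : m * w = w := by
    rw [← map_mul]
    congr 1
    simp
  have hww : w + w = 0 := e.injective (by
    rw [map_add, e.apply_symm_apply, map_zero]
    exact Prod.ext rfl (add_zero _))
  have hw : w ≠ 0 := fun h => by simp [w] at h
  have hπm : π (w + m) = 0 := by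
    rw [hπe, map_add, e.apply_symm_apply, e.apply_symm_apply]
    rfl
  have hwm : w + m ≠ 0 := by
    rw [← map_add]
    intro h
    have h' := congrArg Prod.snd ((EmbeddingLike.map_eq_zero_iff).1 h)
    simp only [Prod.snd_add, Prod.snd_zero, zero_add] at h'
    rw [h', mul_zero] at hr
    exact neg_ne_zero.2 one_ne_zero hr
  let S : Set (ZMod (2 * p)) := {1, -1, w + m, -(w + m)}
  have hmem (x : ZMod (2 * p)) : x ∈ S ↔ x = 1 ∨ x = -1 ∨ x = w + m ∨ x = -(w + m) := Iff.rfl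
  have h1 : (1 : ZMod (2 * p)) ∈ S := by simp [hmem]
  have hneg1 : (-1 : ZMod (2 * p)) ∈ S := by simp [hmem]
  have hwmS : w + m ∈ S := by simp [hmem]
  have hk (k : ℕ) (hk : 0 < k) (hk10 : k < 10) : (k : ZMod (2 * p)) ≠ 0 :=
    ZMod.natCast_ne_zero_of_lt hk (by lia)
  have hone : (1 : ZMod (2 * p)) ≠ 0 := by simpa using hk 1 (by norm_num) (by norm_num)
  have hk2 := hk 2 (by norm_num) (by norm_num)
  have hk8 := hk 8 (by norm_num) (by norm_num)
  push_cast at hk2 hk8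
  have h0 : (0 : ZMod (2 * p)) ∉ S := by
    rw [hmem]
    rintro (h | h | h | h)
    · exact hone h.symm
    · exact neg_ne_zero.2 hone h.symm
    · exact hwm h.symm
    · exact neg_ne_zero.2 hwm h.symm
  have hS : ∀ s ∈ S, -s ∈ S := by
    rintro s (rfl | rfl | rfl | rfl) <;> simp [hmem]
  have hπ1 : π 1 ≠ 0 := by rw [map_one]; exact one_ne_zero
  have hπn1 : π (-1) ≠ 0 := by rw [map_neg, map_one]; exact neg_ne_zero.2 one_ne_zero
  have hodd (x : ZMod (2 * p)) (hxS : x ∈ S) (hx : π x ≠ 0) : x = 1 ∨ x = -1 := by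
    rcases (hmem x).1 hxS with h | h | h | h
    · exact Or.inl h
    · exact Or.inr h
    · exact absurd (h ▸ hπm) hx
    · exact absurd (by rw [h, map_neg, hπm, neg_zero]) hx
  have heven (x : ZMod (2 * p)) (hxS : x ∈ S) (hx : π x = 0) : x = w + m ∨ x = -(w + m) := by
    rcases (hmem x).1 hxS with h | h | h | h
    · exact absurd (h ▸ hx) hπ1
    · exact absurd (h ▸ hx) hπn1
    · exact Or.inl h
    · exact Or.inr h
  refine ⟨S, h0, hS, circulantGraph_connected_of_one_mem h0 hS h1,
    circulantGraph_not_isBipartite_of_one_mem hn h0 hS h1 hwmS hπm,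
    isTwinFree_of_forall h0 hS fun t ht => ?_, ?_⟩
  · by_cases hπt : π t = 0
    · exact eq_zero_of_even_translation hn (by lia) h1 hneg1 hodd ht hπt
    · exfalso
      have hsum : ∀ c : ZMod 2, c ≠ 0 → 1 + c = 0 ∧ -1 + c = 0 := by decide
      have e1 := heven _ (ht 1 h1) (by rw [map_add, map_one]; exact (hsum _ hπt).1)
      have e2 := heven _ (ht (-1) hneg1)
        (by rw [map_add, map_neg, map_one]; exact (hsum _ hπt).2)
      rcases e1 with e1 | e1 <;> rcases e2 with e2 | e2
      · exact hk2 (by linear_combination e1 - e2)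
      · have h22 : (2 : ZMod (2 * p)) = 2 * m := by linear_combination e1 - e2 + hww
        -- From `2 = 2 * m`, squaring gives `4 = -4`, impossible since `2 * p ≥ 10`.
        exact hk8 (by linear_combination (2 + 2 * m) * h22 + 4 * hm)
      · have h22 : (2 : ZMod (2 * p)) = -(2 * m) := by linear_combination e1 - e2 - hww
        exact hk8 (by linear_combination (2 - 2 * m) * h22 + 4 * hm)
      · exact hk2 (by linear_combination e1 - e2)
  · let f : Equiv.Perm (ZMod (2 * p)) :=
      { toFun := fun x => m * x
        invFun := fun x => -(m * x)
        left_inv := fun x => by linear_combination -x * hm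
        right_inv := fun x => by linear_combination -x * hm }
    have hf (x : ZMod (2 * p)) : f x = m * x := rfl
    have hfS (s : ZMod (2 * p)) (hs : s ∈ S) : m * s + w ∈ S := by
      rw [hmem]
      rcases hs with rfl | rfl | rfl | rfl
      · exact Or.inr (Or.inr (Or.inl (by ring)))
      · exact Or.inr (Or.inr (Or.inr (by linear_combination hww)))
      · exact Or.inr (Or.inl (by linear_combination hmw + hm + hww))
      · exact Or.inl (by linear_combination -hmw - hm)
    refine isUnstable_of_preservesDiff h0 hS (f := f) (g := f.trans (Equiv.addRight w))
      (fun x y => ?_) fun hfg => ?_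
    · simp only [Equiv.trans_apply, hf, Equiv.coe_addRight]
      rw [show m * y + w - m * x = m * (y - x) + w by ring]
      refine ⟨fun h => ?_, hfS _⟩
      have := hS _ (hfS _ h)
      rwa [show -(m * (m * (y - x) + w) + w) = y - x by
        linear_combination -(y - x) * hm - hmw - hww] at this
    · have := DFunLike.congr_fun hfg (0 : ZMod (2 * p))
      simp only [Equiv.trans_apply, hf, Equiv.coe_addRight, mul_zero, zero_add] at this
      exact hw this.symm

/-! ### The classification -/

theorem mainTheorem2 (n : ℕ) (hn : 0 < n) :
    (¬ ∃ S : Set (ZMod n), 0 ∉ S ∧ (∀ s ∈ S, -s ∈ S) ∧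
        (SimpleGraph.circulantGraph S).IsNontriviallyUnstable) ↔
      (Odd n ∨ n < 8 ∨ ∃ p : ℕ, p.Prime ∧ p ≡ 3 [MOD 4] ∧ n = 2 * p) := by
  constructor
  · intro hnot
    by_contra! hcon
    obtain ⟨hodd, h8, hp⟩ := hcon
    obtain ⟨k, rfl⟩ := (Nat.not_odd_iff_even.1 hodd).two_dvd
    refine hnot ?_
    by_cases hk : k.Prime
    · have h3 : k % 4 ≠ 3 := fun h => hp k hk h rfl
      have hk2 := (hk.eq_two_or_odd).resolve_left (by lia)
      exact exists_isNontriviallyUnstable_two_mul_prime hk (by lia)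
    · obtain ⟨a, ⟨b, rfl⟩, ha, hab⟩ := Nat.exists_dvd_of_not_prime2 (by lia) hk
      have hb : 2 ≤ b := by
        by_contra! hlt
        interval_cases b <;> lia
      exact exists_isNontriviallyUnstable_two_mul_mul ha hb h8
  · rintro h ⟨S, h0, hS, hu⟩
    have : NeZero n := ⟨hn.ne'⟩
    obtain ⟨S, rfl⟩ := S.toFinite.exists_finset_coe
    rcases Nat.even_or_odd n with heven | hodd
    · have hcases : n = 2 ∨ n = 4 ∨ ∃ p : ℕ, p.Prime ∧ p ≡ 3 [MOD 4] ∧ n = 2 * p := by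
        rcases h with h | h | h
        · exact absurd heven (Nat.not_even_iff_odd.2 h)
        · interval_cases n
          all_goals first | exact absurd heven (by decide) | skip
          · exact Or.inl rfl
          · exact Or.inr (Or.inl rfl)
          -- Order 6 is `2 * 3`, so it falls under the case `p ≡ 3` mod 4.
          · exact Or.inr (Or.inr ⟨3, Nat.prime_three, rfl, rfl⟩)
        · exact Or.inr (Or.inr h)
      rcases hcases with rfl | rfl | ⟨p, hp, hp4, rfl⟩
      · exact not_isNontriviallyUnstable_two h0 hS hu
      · exact not_isNontriviallyUnstable_four h0 hS hu
      · exact not_isNontriviallyUnstable_two_mul_prime hp hp4 h0 hS hu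
    · exact not_isNontriviallyUnstable_of_odd hodd h0 hS hu
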